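/- For an even integer $n\ge 4$, let $H_n$ be the graph on the vertex set $[n]$ that consists of two stars $K_{1,n/2-1}$ and an edge joining their centres: the star centred at $s=1$ has leaves $2,\dots,n/2$, the star centred at $t=n$ has leaves $n/2+1,\dots,n-1$, and $s$ is adjacent to $t$. Let $\mathcal{G}_n$ be the family consisting of $H_n$ and of all graphs obtained from $H_n$ by adding a single edge $\{i,j\}$ between a leaf $i$ of the first star and a leaf $j$ of the second star. A unit flow from $s$ to $t$ in a graph $G$ is a real function $\theta$ on its directed edges with $\theta(u,v)=-\theta(v,u)$, with $\sum_{v\sim u}\theta(u,v)=0$ for every vertex $u\ne s,t$, and with $\sum_{v\sim s}\theta(s,v)=\sum_{u\sim t}\theta(u,t)=1$. The effective resistance is $R_{s,t}(G)=\min_\theta\sum_{\{u,v\}\in E(G)}\theta(u,v)^2$, the minimum being over all unit flows $\theta$ from $s$ to $t$ in $G$. In the adjacency query model the input is the adjacency matrix $x\in\{0,1\}^{n\times n}$ of a graph $G$, accessed through the unitary $O_x|(i,j),b,w\rangle=|(i,j),b\oplus x_{i,j},w\rangle$. A quantum algorithm with $T$ queries prepares $U_TO_xU_{T-1}\cdots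 O_xU_0|\psi_0\rangle$, where the unitaries $U_k$ and the unit vector $|\psi_0\rangle$ (on a finite-dimensional space, with a workspace $w$ of arbitrary finite dimension) do not depend on $x$, measures in the computational basis, and outputs a real number determined by the result. It estimates the effective resistance on $\mathcal{G}_n$ to relative accuracy $\varepsilon$ if for every $G\in\mathcal{G}_n$, with probability at least $2/3$, its output $r$ satisfies $|R_{s,t}(G)-r|\le\varepsilon R_{s,t}(G)$. **Theorem (Lower Bound).** Estimating the effective resistance on the families $\mathcal{G}_n$ to constant relative accuracy requires $\Omega(n)$ quantum queries: there is a constant $c>0$ such that for every even $n\ge 4$ and every $0<\varepsilon\le\frac1{10}$, every quantum query algorithm that estimates the effective resistance between $s$ and $t$ on $\mathcal{G}_n$ to relative accuracy $\varepsilon$ makes at least $cn$ queries. -/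

import Mathlib

noncomputable section

/-! ### Unit flows and effective resistance -/

section EffectiveResistance

/-- `θ` is a unit flow from `s` to `t` in the graph `G`.  A function on the directed edges of `G`
is represented by a function on all ordered pairs of vertices that vanishes off the edges, so that
the sum over the neighbours of `u` is the sum over all vertices. -/
structure IsUnitFlow {V : Type*} [Fintype V] (G : SimpleGraph V) (s t : V) (θ : V → V → ℝ) :
    Prop where
  eq_zero_of_not_adj : ∀ u v, ¬ G.Adj u v → θ u v = 0
  antisymm : ∀ u v, θ u v = - θ v u
  conservation : ∀ u, u ≠ s → u ≠ t → ∑ v, θ u v = 0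
  source : ∑ v, θ s v = 1
  sink : ∑ u, θ u t = 1

/-- The energy `∑_{ {u,v} ∈ E } θ(u,v)²` of a flow.  Each undirected edge occurs twice among the
ordered pairs, whence the factor `1/2`. -/
def flowEnergy {V : Type*} [Fintype V] (θ : V → V → ℝ) : ℝ :=
  (∑ u, ∑ v, θ u v ^ 2) / 2

/-- The effective resistance `R_{s,t}(G)`: the least energy of a unit flow from `s` to `t`. -/
def effectiveResistance {V : Type*} [Fintype V] (G : SimpleGraph V) (s t : V) : ℝ :=
  sInf {r : ℝ | ∃ θ : V → V → ℝ, IsUnitFlow G s t θ ∧ flowEnergy θ = r}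

end EffectiveResistance

/-! ### Quantum query algorithms -/

/-- The computational basis of the state space of a query algorithm on input strings
`x : ι → Bool`: query-index register, one-bit answer register, workspace of dimension `d`. -/
abbrev QueryBasis (ι : Type) (d : ℕ) : Type := ι × Bool × Fin d

/-- The state space, a finite-dimensional complex Hilbert space. -/
abbrev QuerySpace (ι : Type) [Fintype ι] (d : ℕ) : Type :=
  EuclideanSpace ℂ (QueryBasis ι d)

/-- The permutation `(i, b, w) ↦ (i, b ⊕ x i, w)` of the computational basis. -/
def queryPerm {ι : Type} (x : ι → Bool) (d : ℕ) : Equiv.Perm (QueryBasis ι d) where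
  toFun p := (p.1, xor p.2.1 (x p.1), p.2.2)
  invFun p := (p.1, xor p.2.1 (x p.1), p.2.2)
  left_inv p := by simp
  right_inv p := by simp

/-- The query unitary `O_x |i, b, w⟩ = |i, b ⊕ x i, w⟩`. -/
def queryOracle {ι : Type} [Fintype ι] (x : ι → Bool) (d : ℕ) :
    QuerySpace ι d ≃ₗᵢ[ℂ] QuerySpace ι d :=
  LinearIsometryEquiv.piLpCongrLeft 2 ℂ ℂ (queryPerm x d)

/-- A quantum query algorithm with real outputs on input strings `x : ι → Bool`: a unit initial
state, and unitaries independent of the input which are interleaved with `queries` applications of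
the query unitary; at the end the state is measured in the computational basis and the output is
read off from the result. -/
structure QuantumQueryAlgorithm (ι : Type) [Fintype ι] where
  /-- the number of queries -/
  queries : ℕ
  /-- the dimension of the workspace -/
  workDim : ℕ
  /-- the initial state -/
  init : QuerySpace ι workDim
  norm_init : ‖init‖ = 1
  /-- `unitary k` is applied directly after the `k`-th query, and `unitary 0` before the first -/
  unitary : ℕ → (QuerySpace ι workDim ≃ₗᵢ[ℂ] QuerySpace ι workDim)
  /-- the output on each measurement result -/
  output : QueryBasis ι workDim → ℝ

namespace QuantumQueryAlgorithm

/-- The state `U_k O_x U_{k-1} ⋯ O_x U_0 |init⟩` after `k` queries to the input `x`. -/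
def state {ι : Type} [Fintype ι] (A : QuantumQueryAlgorithm ι) (x : ι → Bool) :
    ℕ → QuerySpace ι A.workDim
  | 0 => A.unitary 0 A.init
  | k + 1 => A.unitary (k + 1) (queryOracle x A.workDim (A.state x k))

open Classical in
/-- The probability that on input `x` the output of `A` lies in the set `S`. -/
def outputProb {ι : Type} [Fintype ι] (A : QuantumQueryAlgorithm ι) (x : ι → Bool) (S : Set ℝ) :
    ℝ :=
  ∑ b : QueryBasis ι A.workDim, if A.output b ∈ S then ‖A.state x A.queries b‖ ^ 2 else 0

end QuantumQueryAlgorithm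

/-! ### The adjacency query model -/

open Classical in
/-- The input string of the adjacency model: the adjacency matrix of the graph. -/
def adjacencyString {n : ℕ} (G : SimpleGraph (Fin n)) : Fin n × Fin n → Bool :=
  fun p => decide (G.Adj p.1 p.2)

/-- `A` estimates the effective resistance between `s` and `t` on the graphs in `𝒢`, given by
adjacency queries, to relative accuracy `ε` with bounded error: on each graph of `𝒢`, with
probability at least `2/3`, the output `r` satisfies `|R_{s,t}(G) - r| ≤ ε R_{s,t}(G)`. -/
def EstimatesEffectiveResistance {n : ℕ} (A : QuantumQueryAlgorithm (Fin n × Fin n))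
    (𝒢 : Set (SimpleGraph (Fin n))) (s t : Fin n) (ε : ℝ) : Prop :=
  ∀ G ∈ 𝒢, 2 / 3 ≤ A.outputProb (adjacencyString G)
    {r : ℝ | |effectiveResistance G s t - r| ≤ ε * effectiveResistance G s t}

/-! ### Two stars joined by an edge -/

/-- For even `n`: two stars with `n/2 - 1` leaves each, whose centres are joined by an edge.  The
centre of the first star is `0`, with leaves `1, …, n/2 - 1`; the centre of the second star is
`n - 1`, with leaves `n/2, …, n - 2`. -/
def twoStars (n : ℕ) : SimpleGraph (Fin n) :=
  SimpleGraph.fromRel fun u v =>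
    ((u : ℕ) = 0 ∧ (v : ℕ) = n - 1) ∨
    ((u : ℕ) = 0 ∧ 1 ≤ (v : ℕ) ∧ (v : ℕ) < n / 2) ∨
    ((u : ℕ) = n - 1 ∧ n / 2 ≤ (v : ℕ) ∧ (v : ℕ) < n - 1)

/-- The family consisting of `twoStars n` and of all graphs obtained from it by adding one edge
between a leaf of the first star and a leaf of the second. -/
def twoStarsFamily (n : ℕ) : Set (SimpleGraph (Fin n)) :=
  {twoStars n} ∪
  {G | ∃ i j : Fin n, (1 ≤ (i : ℕ) ∧ (i : ℕ) < n / 2) ∧ (n / 2 ≤ (j : ℕ) ∧ (j : ℕ) < n - 1) ∧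
    G = twoStars n ⊔ SimpleGraph.edge i j}

end

/-!
The effective resistance between the two centres is `1` in `twoStars n`, where the edge joining the
centres is the only path from `s` to `t`, and `3 / 4` once an edge between two leaves is added,
which puts a path of length three in parallel with that edge. Both values come from
`effectiveResistance_eq_of_ohm`: a unit flow which is the gradient of a potential has least energy,
and this energy is the potential difference between source and sink. For `ε ≤ 1 / 10` the outputs
accepted for the two values are disjoint, so an estimator tells the adjacency matrix of `twoStars n`
apart from those of all `(n / 2 - 1) ^ 2` graphs with an added edge.

That this takes `Ω(n)` queries is the hybrid argument for unstructured search. Replacing the input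
`x` by an input `y` which differs from it only on the index set `D` moves the final state by at most
the sum over the queries of `2 √m`, where `m` is the weight that the state on input `x` puts on `D`
just before the query (`norm_state_sub_le`, `norm_queryOracle_sub_sq_le`). For disjoint sets `D`
these weights add up to at most `1` at each query, so that the squared displacements caused by any
number of such inputs have total at most `4 T ^ 2` (`sum_norm_state_sub_sq_le`). Each single
displacement must however be bounded below by a constant for the outputs to be distinguished
(`one_le_mul_norm_state_sub_sq`), whence `(n / 2 - 1) ^ 2 ≤ 72 T ^ 2`.
-/

/-! ### Flows and potentials -/

section Flows

variable {V : Type*} [Fintype V] {G : SimpleGraph V} {s t : V}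

/-- Summation by parts: pairing a unit flow with the gradient of a potential gives the potential
difference between source and sink, twice because each edge occurs in both directions. -/
lemma IsUnitFlow.sum_mul_sub {θ : V → V → ℝ} (hθ : IsUnitFlow G s t θ) (hst : s ≠ t)
    (φ : V → ℝ) : ∑ u, ∑ v, θ u v * (φ u - φ v) = 2 * (φ s - φ t) := by
  classical
  have hdiv : ∀ u, ∑ v, θ u v = (if u = s then 1 else 0) - (if u = t then 1 else 0) := by
    intro u
    by_cases hs : u = s
    · subst hs; simp [hst, hθ.source]
    · by_cases ht : u = t
      · subst ht
        have : ∑ v, θ u v = - ∑ v, θ v u := by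
          rw [← Finset.sum_neg_distrib]
          exact Finset.sum_congr rfl fun v _ => hθ.antisymm u v
        rw [this, hθ.sink]; simp [hs]
      · simp [hs, ht, hθ.conservation u hs ht]
  have h1 : ∑ u, ∑ v, θ u v * φ u = φ s - φ t := by
    simp_rw [← Finset.sum_mul, hdiv, sub_mul, Finset.sum_sub_distrib]
    simp
  have h2 : ∑ u, ∑ v, θ u v * φ v = -(φ s - φ t) := by
    rw [Finset.sum_comm, ← h1, ← Finset.sum_neg_distrib]
    refine Finset.sum_congr rfl fun v _ => ?_
    rw [← Finset.sum_neg_distrib]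
    refine Finset.sum_congr rfl fun u _ => ?_
    rw [hθ.antisymm u v]; ring
  simp_rw [mul_sub, Finset.sum_sub_distrib]
  rw [h1, h2]; ring

/-- Thomson's principle: a unit flow obeying Ohm's law for a potential `φ` has least energy, and
this energy is the potential difference. -/
lemma effectiveResistance_eq_of_ohm {θ : V → V → ℝ} (hθ : IsUnitFlow G s t θ) (hst : s ≠ t)
    (φ : V → ℝ) (ohm : ∀ u v, G.Adj u v → θ u v = φ u - φ v) :
    effectiveResistance G s t = φ s - φ t := by
  have key : ∀ η, IsUnitFlow G s t η → ∑ u, ∑ v, η u v * θ u v = 2 * (φ s - φ t) := by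
    intro η hη
    rw [← hη.sum_mul_sub hst φ]
    refine Finset.sum_congr rfl fun u _ => Finset.sum_congr rfl fun v _ => ?_
    by_cases h : G.Adj u v
    · rw [ohm u v h]
    · rw [hη.eq_zero_of_not_adj u v h]; ring
  have hE : flowEnergy θ = φ s - φ t := by
    have := key θ hθ
    simp_rw [← sq] at this
    rw [flowEnergy, this]; ring
  refine IsLeast.csInf_eq ⟨⟨θ, hθ, hE⟩, ?_⟩
  rintro _ ⟨η, hη, rfl⟩
  have hsq : 0 ≤ ∑ u, ∑ v, (η u v - θ u v) ^ 2 :=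
    Finset.sum_nonneg fun u _ => Finset.sum_nonneg fun v _ => sq_nonneg _
  have hexp : ∑ u, ∑ v, (η u v - θ u v) ^ 2
      = ∑ u, ∑ v, η u v ^ 2 - 2 * ∑ u, ∑ v, η u v * θ u v + ∑ u, ∑ v, θ u v ^ 2 := by
    simp_rw [Finset.mul_sum, ← Finset.sum_sub_distrib, ← Finset.sum_add_distrib]
    refine Finset.sum_congr rfl fun u _ => Finset.sum_congr rfl fun v _ => by ring
  rw [hexp, key η hη] at hsq
  unfold flowEnergy at hE ⊢
  linarith

end Flows

section EdgeFlow

variable {V : Type*} [DecidableEq V] {G : SimpleGraph V} {s t : V}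

/-- The unit flow along the single edge from `a` to `b`. -/
noncomputable def edgeFlow (a b u v : V) : ℝ :=
  (if u = a ∧ v = b then 1 else 0) - (if u = b ∧ v = a then 1 else 0)

lemma edgeFlow_antisymm (a b u v : V) : edgeFlow a b u v = - edgeFlow a b v u := by
  unfold edgeFlow
  simp only [and_comm (a := v = _)]
  ring

lemma edgeFlow_eq_zero {a b : V} (hab : G.Adj a b) {u v : V} (h : ¬ G.Adj u v) :
    edgeFlow a b u v = 0 := by
  have h1 : ¬ (u = a ∧ v = b) := by rintro ⟨rfl, rfl⟩; exact h hab
  have h2 : ¬ (u = b ∧ v = a) := by rintro ⟨rfl, rfl⟩; exact h hab.symm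
  simp [edgeFlow, h1, h2]

variable [Fintype V]

lemma sum_edgeFlow (a b u : V) :
    ∑ v, edgeFlow a b u v = (if u = a then 1 else 0) - (if u = b then 1 else 0) := by
  simp [edgeFlow, Finset.sum_sub_distrib, ite_and]

/-- A unit flow is an antisymmetric function on the edges with divergence `1` at `s`, `-1` at `t`
and `0` elsewhere. -/
lemma isUnitFlow_of_divergence {θ : V → V → ℝ} (hst : s ≠ t)
    (h0 : ∀ u v, ¬ G.Adj u v → θ u v = 0) (ha : ∀ u v, θ u v = - θ v u)
    (hd : ∀ u, ∑ v, θ u v = (if u = s then 1 else 0) - (if u = t then 1 else 0)) :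
    IsUnitFlow G s t θ where
  eq_zero_of_not_adj := h0
  antisymm := ha
  conservation u hs ht := by simp [hd, hs, ht]
  source := by simp [hd, hst]
  sink := by
    rw [Finset.sum_congr rfl fun u _ => ha u t, Finset.sum_neg_distrib, hd]
    simp [hst.symm]

end EdgeFlow

/-! ### Effective resistances of the family -/

section TwoStars

variable {n : ℕ}

lemma twoStars_adj {u v : Fin n} : (twoStars n).Adj u v ↔ u ≠ v ∧
    ((((u : ℕ) = 0 ∧ (v : ℕ) = n - 1) ∨ ((u : ℕ) = 0 ∧ 1 ≤ (v : ℕ) ∧ (v : ℕ) < n / 2) ∨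
      ((u : ℕ) = n - 1 ∧ n / 2 ≤ (v : ℕ) ∧ (v : ℕ) < n - 1)) ∨
    (((v : ℕ) = 0 ∧ (u : ℕ) = n - 1) ∨ ((v : ℕ) = 0 ∧ 1 ≤ (u : ℕ) ∧ (u : ℕ) < n / 2) ∨
      ((v : ℕ) = n - 1 ∧ n / 2 ≤ (u : ℕ) ∧ (u : ℕ) < n - 1))) := Iff.rfl

lemma effectiveResistance_twoStars (h4 : 4 ≤ n) {s t : Fin n} (hs : (s : ℕ) = 0)
    (ht : (t : ℕ) = n - 1) : effectiveResistance (twoStars n) s t = 1 := by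
  have hst : s ≠ t := by rw [Ne, Fin.ext_iff]; omega
  have hadj : (twoStars n).Adj s t := by
    rw [twoStars_adj]; exact ⟨hst, by simp [hs, ht]⟩
  have hflow : IsUnitFlow (twoStars n) s t (edgeFlow s t) :=
    isUnitFlow_of_divergence hst (fun u v h => edgeFlow_eq_zero hadj h) (edgeFlow_antisymm s t)
      (sum_edgeFlow s t)
  rw [effectiveResistance_eq_of_ohm hflow hst (fun u => if (u : ℕ) < n / 2 then 1 else 0)]
  · have h1 : 0 < n / 2 := by omega
    have h2 : ¬ (n - 1 < n / 2) := by omega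
    simp [hs, ht, h1, h2]
  · intro u v h
    obtain ⟨-, h⟩ := twoStars_adj.1 h
    simp only [edgeFlow, hs, ht, Fin.ext_iff]
    split_ifs <;> first | omega | norm_num

lemma effectiveResistance_twoStars_sup_edge {s t i j : Fin n}
    (hs : (s : ℕ) = 0) (ht : (t : ℕ) = n - 1)
    (hi : 1 ≤ (i : ℕ) ∧ (i : ℕ) < n / 2) (hj : n / 2 ≤ (j : ℕ) ∧ (j : ℕ) < n - 1) :
    effectiveResistance (twoStars n ⊔ SimpleGraph.edge i j) s t = 3 / 4 := by
  set G := twoStars n ⊔ SimpleGraph.edge i j with hG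
  have hst : s ≠ t := by rw [Ne, Fin.ext_iff]; omega
  have h_st : G.Adj s t := Or.inl (twoStars_adj.2 ⟨hst, by simp [hs, ht]⟩)
  have h_si : G.Adj s i := Or.inl (twoStars_adj.2
    ⟨by rw [Ne, Fin.ext_iff]; omega, Or.inl (Or.inr (Or.inl ⟨hs, hi⟩))⟩)
  have h_jt : G.Adj j t := Or.inl (twoStars_adj.2
    ⟨by rw [Ne, Fin.ext_iff]; omega, Or.inr (Or.inr (Or.inr ⟨ht, hj⟩))⟩)
  have h_ij : G.Adj i j := Or.inr ((SimpleGraph.edge_adj i j i j).2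
    ⟨Or.inl ⟨rfl, rfl⟩, by rw [Ne, Fin.ext_iff]; omega⟩)
  -- Between `s` and `t`, parallel paths of lengths `1` and `3` share the flow in the ratio `3 : 1`.
  have hflow : IsUnitFlow G s t (fun u v => 3 / 4 * edgeFlow s t u v
      + 1 / 4 * (edgeFlow s i u v + edgeFlow i j u v + edgeFlow j t u v)) := by
    refine isUnitFlow_of_divergence hst (fun u v h => ?_) (fun u v => ?_) (fun u => ?_)
    · simp [edgeFlow_eq_zero h_st h, edgeFlow_eq_zero h_si h, edgeFlow_eq_zero h_ij h,
        edgeFlow_eq_zero h_jt h]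
    · rw [edgeFlow_antisymm s t u v, edgeFlow_antisymm s i u v, edgeFlow_antisymm i j u v,
        edgeFlow_antisymm j t u v]
      ring
    · simp only [Finset.sum_add_distrib, ← Finset.mul_sum, sum_edgeFlow]
      ring
  rw [effectiveResistance_eq_of_ohm hflow hst (fun u => if (u : ℕ) = i then 1 / 2 else
    if (u : ℕ) = j then 1 / 4 else if (u : ℕ) < n / 2 then 3 / 4 else 0)]
  · have h1 : 0 < n / 2 := by omega
    have h2 : ¬ (n - 1 < n / 2) := by omega
    have h3 : 0 ≠ (i : ℕ) := by omega
    have h7 : 0 ≠ (j : ℕ) := by omega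
    have h5 : n - 1 ≠ (i : ℕ) := by omega
    have h6 : n - 1 ≠ (j : ℕ) := by omega
    simp only [hs, ht, h1, h2, h3, h7, h5, h6, if_true, if_false]
    norm_num
  · have ohm : ∀ u v : Fin n, (((u : ℕ) = 0 ∧ (v : ℕ) = n - 1) ∨
        ((u : ℕ) = 0 ∧ 1 ≤ (v : ℕ) ∧ (v : ℕ) < n / 2) ∨
        ((u : ℕ) = n - 1 ∧ n / 2 ≤ (v : ℕ) ∧ (v : ℕ) < n - 1)) ∨ (u = i ∧ v = j) →
        3 / 4 * edgeFlow s t u v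
          + 1 / 4 * (edgeFlow s i u v + edgeFlow i j u v + edgeFlow j t u v)
        = (if (u : ℕ) = i then 1 / 2 else
            if (u : ℕ) = j then 1 / 4 else if (u : ℕ) < n / 2 then 3 / 4 else 0)
          - (if (v : ℕ) = i then 1 / 2 else
            if (v : ℕ) = j then 1 / 4 else if (v : ℕ) < n / 2 then 3 / 4 else (0 : ℝ)) := by
      intro u v h
      simp only [edgeFlow, hs, ht, Fin.ext_iff] at h ⊢
      clear hflow h_st h_si h_jt h_ij
      rcases h with (h | h | h) | h
      · simp (disch := omega) only [if_pos, if_neg]; norm_num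
      · by_cases hv : (v : ℕ) = i <;> simp (disch := omega) only [if_pos, if_neg] <;> norm_num
      · by_cases hv : (v : ℕ) = j <;> simp (disch := omega) only [if_pos, if_neg] <;> norm_num
      · simp (disch := omega) only [if_pos, if_neg]; norm_num
    intro u v h
    -- Both sides change sign when `u` and `v` are interchanged.
    have hrev := hflow.antisymm u v
    rcases h with h | h
    · rcases (twoStars_adj.1 h).2 with h | h
      · exact ohm u v (Or.inl h)
      · linarith [ohm v u (Or.inl h)]
    · rcases ((SimpleGraph.edge_adj i j u v).1 h).1 with h | h
      · exact ohm u v (Or.inr h)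
      · linarith [ohm v u (Or.inr h.symm)]

end TwoStars

/-! ### The hybrid argument -/

section Hybrid

variable {ι : Type} [Fintype ι] {d : ℕ}

/-- The weight which the state `ψ` puts on querying the index `i`. -/
noncomputable def queryWeight (ψ : QuerySpace ι d) (i : ι) : ℝ :=
  ∑ q : Bool × Fin d, ‖ψ (i, q)‖ ^ 2

lemma queryWeight_nonneg (ψ : QuerySpace ι d) (i : ι) : 0 ≤ queryWeight ψ i :=
  Finset.sum_nonneg fun _ _ => sq_nonneg _

lemma sum_queryWeight (ψ : QuerySpace ι d) : ∑ i, queryWeight ψ i = ‖ψ‖ ^ 2 := by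
  rw [EuclideanSpace.norm_sq_eq, Fintype.sum_prod_type]
  rfl

lemma queryOracle_apply (x : ι → Bool) (ψ : QuerySpace ι d) (p : QueryBasis ι d) :
    queryOracle x d ψ p = ψ (p.1, xor p.2.1 (x p.1), p.2.2) := rfl

/-- A query only permutes the amplitudes that belong to one index. -/
lemma queryWeight_queryOracle (x : ι → Bool) (ψ : QuerySpace ι d) (i : ι) :
    queryWeight (queryOracle x d ψ) i = queryWeight ψ i := by
  simp only [queryWeight, queryOracle_apply, Fintype.sum_prod_type, Fintype.sum_bool]
  cases x i <;> simp [add_comm]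

lemma norm_sub_sq_le_two_mul_add {E : Type*} [SeminormedAddCommGroup E] (a b : E) :
    ‖a - b‖ ^ 2 ≤ 2 * ‖a‖ ^ 2 + 2 * ‖b‖ ^ 2 := by
  nlinarith [norm_sub_le a b, norm_nonneg (a - b), sq_nonneg (‖a‖ - ‖b‖)]

/-- Inputs that agree off `D` have query unitaries that agree off the span of the basis states
which query an index in `D`. -/
lemma norm_queryOracle_sub_sq_le {x y : ι → Bool} {D : Finset ι} (h : ∀ i ∉ D, y i = x i)
    (ψ : QuerySpace ι d) :
    ‖queryOracle y d ψ - queryOracle x d ψ‖ ^ 2 ≤ 4 * ∑ i ∈ D, queryWeight ψ i := by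
  rw [← sum_queryWeight, Finset.mul_sum, ← Finset.sum_subset (Finset.subset_univ D)]
  · refine Finset.sum_le_sum fun i _ => ?_
    calc queryWeight (queryOracle y d ψ - queryOracle x d ψ) i
        ≤ ∑ q : Bool × Fin d, (2 * ‖queryOracle y d ψ (i, q)‖ ^ 2
            + 2 * ‖queryOracle x d ψ (i, q)‖ ^ 2) :=
          Finset.sum_le_sum fun q _ => norm_sub_sq_le_two_mul_add _ _
      _ = 2 * queryWeight (queryOracle y d ψ) i + 2 * queryWeight (queryOracle x d ψ) i := by
          rw [Finset.sum_add_distrib, ← Finset.mul_sum, ← Finset.mul_sum]; rfl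
      _ = 4 * queryWeight ψ i := by
          rw [queryWeight_queryOracle, queryWeight_queryOracle]; ring
  · intro i _ hi
    refine Finset.sum_eq_zero fun q _ => ?_
    rw [PiLp.sub_apply, queryOracle_apply, queryOracle_apply, h i hi]
    simp

namespace QuantumQueryAlgorithm

variable (A : QuantumQueryAlgorithm ι)

lemma norm_state (x : ι → Bool) (k : ℕ) : ‖A.state x k‖ = 1 := by
  induction k with
  | zero => simp [state, A.norm_init]
  | succ k ih => simp [state, ih]

/-- The hybrid inequality: replacing the queries to `x` by queries to `y` one at a time. -/
lemma norm_state_sub_le (x y : ι → Bool) (T : ℕ) :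
    ‖A.state y T - A.state x T‖ ≤ ∑ k ∈ Finset.range T,
      ‖queryOracle y A.workDim (A.state x k) - queryOracle x A.workDim (A.state x k)‖ := by
  induction T with
  | zero => simp [state]
  | succ T ih =>
    rw [Finset.sum_range_succ]
    simp only [state]
    rw [← map_sub, LinearIsometryEquiv.norm_map,
      ← sub_add_sub_cancel _ (queryOracle y A.workDim (A.state x T)) _]
    refine (norm_add_le _ _).trans (add_le_add_left ?_ _)
    rwa [← map_sub, LinearIsometryEquiv.norm_map]

/-- If the sets on which the inputs `y a` differ from `x` are pairwise disjoint, then `T` queries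
move the state on input `x` by little on average over `a`. -/
lemma sum_norm_state_sub_sq_le {κ : Type*} [Fintype κ] (x : ι → Bool) (y : κ → ι → Bool)
    (D : κ → Finset ι) (hD : Pairwise fun a b => Disjoint (D a) (D b))
    (hy : ∀ a, ∀ i ∉ D a, y a i = x i) (T : ℕ) :
    ∑ a, ‖A.state (y a) T - A.state x T‖ ^ 2 ≤ 4 * (T : ℝ) ^ 2 := by
  classical
  have hone : ∀ k, ∑ a, ∑ i ∈ D a, queryWeight (A.state x k) i ≤ 1 := by
    intro k
    rw [← Finset.sum_biUnion fun a _ b _ hab => hD hab]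
    calc _ ≤ ∑ i, queryWeight (A.state x k) i :=
          Finset.sum_le_sum_of_subset_of_nonneg (Finset.subset_univ _)
            fun i _ _ => queryWeight_nonneg _ i
      _ = 1 := by rw [sum_queryWeight, A.norm_state, one_pow]
  have hsingle : ∀ a, ‖A.state (y a) T - A.state x T‖ ^ 2 ≤
      T * ∑ k ∈ Finset.range T, 4 * ∑ i ∈ D a, queryWeight (A.state x k) i := by
    intro a
    calc _ ≤ (∑ k ∈ Finset.range T, ‖queryOracle (y a) A.workDim (A.state x k)
            - queryOracle x A.workDim (A.state x k)‖) ^ 2 :=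
          pow_le_pow_left₀ (norm_nonneg _) (A.norm_state_sub_le x (y a) T) 2
      _ ≤ T * ∑ k ∈ Finset.range T, ‖queryOracle (y a) A.workDim (A.state x k)
            - queryOracle x A.workDim (A.state x k)‖ ^ 2 := by
          simpa using sq_sum_le_card_mul_sum_sq (s := Finset.range T)
            (f := fun k => ‖queryOracle (y a) A.workDim (A.state x k)
              - queryOracle x A.workDim (A.state x k)‖)
      _ ≤ _ := by
          gcongr with k
          exact norm_queryOracle_sub_sq_le (hy a) _
  calc _ ≤ ∑ a, T * ∑ k ∈ Finset.range T, 4 * ∑ i ∈ D a, queryWeight (A.state x k) i :=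
        Finset.sum_le_sum fun a _ => hsingle a
    _ = T * ∑ k ∈ Finset.range T, 4 * ∑ a, ∑ i ∈ D a, queryWeight (A.state x k) i := by
        rw [← Finset.mul_sum, Finset.sum_comm]
        simp_rw [Finset.mul_sum]
    _ ≤ T * ∑ k ∈ Finset.range T, 4 * 1 := by
        gcongr with k
        exact hone k
    _ = 4 * (T : ℝ) ^ 2 := by
        simp; ring

/-! ### Distinguishing inputs -/

lemma outputProb_add_le_one (x : ι → Bool) {S S' : Set ℝ} (h : Disjoint S S') :
    A.outputProb x S + A.outputProb x S' ≤ 1 := by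
  classical
  calc _ ≤ ∑ b, ‖A.state x A.queries b‖ ^ 2 := by
        unfold outputProb
        rw [← Finset.sum_add_distrib]
        refine Finset.sum_le_sum fun b _ => ?_
        have := sq_nonneg ‖A.state x A.queries b‖
        by_cases h1 : A.output b ∈ S
        · simp [h1, Set.disjoint_left.1 h h1]
        · by_cases h2 : A.output b ∈ S' <;> simp [h1, h2]
    _ = 1 := by rw [← EuclideanSpace.norm_sq_eq, A.norm_state, one_pow]

/-- Continuity of the output probability in the final state, from the pointwise inequality
`(a + b) ^ 2 ≤ 3 / 2 * a ^ 2 + 3 * b ^ 2`. The factor `3 / 2` is less than the ratio `2` of the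
probabilities `2 / 3` and `1 / 3` that are to be separated. -/
lemma outputProb_le (x y : ι → Bool) (S : Set ℝ) :
    A.outputProb x S ≤
      3 / 2 * A.outputProb y S + 3 * ‖A.state y A.queries - A.state x A.queries‖ ^ 2 := by
  classical
  unfold outputProb
  rw [EuclideanSpace.norm_sq_eq, Finset.mul_sum, Finset.mul_sum, ← Finset.sum_add_distrib]
  refine Finset.sum_le_sum fun b _ => ?_
  rw [PiLp.sub_apply]
  set u := A.state x A.queries b
  set v := A.state y A.queries b
  have h1 : ‖u‖ ≤ ‖v‖ + ‖v - u‖ := norm_le_norm_add_norm_sub v u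
  split_ifs
  · nlinarith [norm_nonneg u, norm_nonneg v, sq_nonneg (‖v‖ - 2 * ‖v - u‖)]
  · positivity

/-- Inputs on which the output lies with probability at least `2 / 3` in disjoint sets lead to
final states at distance bounded below. -/
lemma one_le_mul_norm_state_sub_sq {x y : ι → Bool} {S S' : Set ℝ} (h : Disjoint S S')
    (hx : 2 / 3 ≤ A.outputProb x S) (hy : 2 / 3 ≤ A.outputProb y S') :
    1 ≤ 18 * ‖A.state y A.queries - A.state x A.queries‖ ^ 2 := by
  linarith [A.outputProb_add_le_one y h, A.outputProb_le x y S]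

/-- A bounded-error algorithm that tells `x` apart from inputs which differ from it on pairwise
disjoint sets needs a number of queries of the order of the square root of their number. -/
lemma card_le_mul_queries_sq {κ : Type*} [Fintype κ] (x : ι → Bool) (y : κ → ι → Bool)
    (D : κ → Finset ι) (hD : Pairwise fun a b => Disjoint (D a) (D b))
    (hy : ∀ a, ∀ i ∉ D a, y a i = x i) {S S' : Set ℝ} (h : Disjoint S S')
    (hx : 2 / 3 ≤ A.outputProb x S) (hy' : ∀ a, 2 / 3 ≤ A.outputProb (y a) S') :
    (Fintype.card κ : ℝ) ≤ 72 * (A.queries : ℝ) ^ 2 := by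
  have h1 := A.sum_norm_state_sub_sq_le x y D hD hy A.queries
  have h2 : ∑ _a : κ, (1 : ℝ) ≤
      ∑ a, 18 * ‖A.state (y a) A.queries - A.state x A.queries‖ ^ 2 :=
    Finset.sum_le_sum fun a _ => A.one_le_mul_norm_state_sub_sq h hx (hy' a)
  rw [← Finset.mul_sum] at h2
  simp only [Finset.sum_const, Finset.card_univ, nsmul_eq_mul, mul_one] at h2
  linarith

end QuantumQueryAlgorithm

end Hybrid

/-! ### The lower bound -/

lemma adjacencyString_sup_edge_of_notMem {n : ℕ} (G : SimpleGraph (Fin n)) (i j : Fin n)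
    {p : Fin n × Fin n} (hp : p ∉ ({(i, j), (j, i)} : Finset (Fin n × Fin n))) :
    adjacencyString (G ⊔ SimpleGraph.edge i j) p = adjacencyString G p := by
  obtain ⟨u, v⟩ := p
  simp only [Finset.mem_insert, Finset.mem_singleton, Prod.mk.injEq, not_or] at hp
  simp only [adjacencyString, decide_eq_decide, SimpleGraph.sup_adj, SimpleGraph.edge_adj]
  tauto

theorem mainTheorem7 :
    ∃ c : ℝ, 0 < c ∧ ∀ (n : ℕ) (_hn : Even n) (h4 : 4 ≤ n) (ε : ℝ), 0 < ε → ε ≤ 1 / 10 →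
      ∀ A : QuantumQueryAlgorithm (Fin n × Fin n),
        EstimatesEffectiveResistance A (twoStarsFamily n)
          (⟨0, by omega⟩ : Fin n) (⟨n - 1, by omega⟩ : Fin n) ε →
        c * (n : ℝ) ≤ (A.queries : ℝ) := by
  -- The constant: `(n / 4) ^ 2 ≤ (n / 2 - 1) ^ 2 ≤ 72 T ^ 2`, and `16 * 72 ≤ 40 ^ 2`.
  refine ⟨1 / 40, by norm_num, ?_⟩
  intro n hn h4 ε hε hε' A hA
  obtain ⟨m, rfl⟩ : ∃ m, n = 2 * (m + 1) := by
    obtain ⟨k, rfl⟩ := hn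
    exact ⟨k - 1, by omega⟩
  let i : Fin m → Fin (2 * (m + 1)) := fun a => ⟨a + 1, by omega⟩
  let j : Fin m → Fin (2 * (m + 1)) := fun b => ⟨m + 1 + b, by omega⟩
  have hi : ∀ a, 1 ≤ (i a : ℕ) ∧ (i a : ℕ) < 2 * (m + 1) / 2 := fun a => by
    simp only [i]; omega
  have hj : ∀ b, 2 * (m + 1) / 2 ≤ (j b : ℕ) ∧ (j b : ℕ) < 2 * (m + 1) - 1 := fun b => by
    simp only [j]; omega
  have h0 := hA _ (Or.inl rfl)
  have h1 := fun a b => hA _ (Or.inr ⟨i a, j b, hi a, hj b, rfl⟩)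
  have hR := fun a b => effectiveResistance_twoStars_sup_edge (s := ⟨0, by omega⟩)
    (t := ⟨2 * (m + 1) - 1, by omega⟩) rfl rfl (hi a) (hj b)
  simp only [hR] at h1
  rw [effectiveResistance_twoStars h4 rfl rfl] at h0
  have hdisj : Disjoint {r : ℝ | |1 - r| ≤ ε * 1} {r : ℝ | |3 / 4 - r| ≤ ε * (3 / 4)} := by
    refine Set.disjoint_left.2 fun r hr hr' => ?_
    simp only [Set.mem_ofPred_eq, abs_le] at hr hr'
    linarith
  have hcard := A.card_le_mul_queries_sq (κ := Fin m × Fin m) (adjacencyString (twoStars _))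
    (fun q => adjacencyString (twoStars _ ⊔ SimpleGraph.edge (i q.1) (j q.2)))
    (fun q => {(i q.1, j q.2), (j q.2, i q.1)}) ?_
    (fun q p hp => adjacencyString_sup_edge_of_notMem _ _ _ hp) hdisj h0 (fun q => h1 q.1 q.2)
  · simp only [Fintype.card_prod, Fintype.card_fin, Nat.cast_mul] at hcard
    have hm : (1 : ℝ) ≤ m := by exact_mod_cast (by omega : 1 ≤ m)
    have hT : (0 : ℝ) ≤ A.queries := Nat.cast_nonneg _
    push_cast
    refine abs_le_of_sq_le_sq' ?_ hT |>.2
    nlinarith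
  -- Each added edge changes two matrix entries, and these determine the edge.
  · rintro ⟨a, b⟩ ⟨a', b'⟩ hne
    rw [Finset.disjoint_left]
    intro p hp hp'
    apply hne
    simp only [Finset.mem_insert, Finset.mem_singleton] at hp hp'
    rcases hp with rfl | rfl <;>
      simp only [Prod.mk.injEq, i, j, Fin.ext_iff] at hp' ⊢ <;> omega
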